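/- Let $0<q<1$, $\lambda>0$, $\eta\in\mathbb{R}$, and put $b=\lambda-i\eta$, $\eta_q=\eta\ln q$. Let $$d_{k+1}^{(b)}=\frac{(1-q^{k})(1-q^{2\lambda+k-1})}{4\,(1-q^{\lambda+k-1}\cos\eta_q)(1-q^{\lambda+k}\cos\eta_q)},\qquad k\ge 1 .$$ A parameter sequence of $\{d_{k+1}^{(b)}\}_{k\ge1}$ is a real sequence $\{g_{k+1}\}_{k\ge0}$ with $0\le g_1<1$, $0<g_{k+1}<1$ and $d_{k+1}^{(b)}=(1-g_k)\,g_{k+1}$ for all $k\ge1$; a sequence that has a parameter sequence is called a positive chain sequence, and its maximal parameter sequence is the parameter sequence that is termwise greater than or equal to every parameter sequence. Write $(a;q)_n=\prod_{j=0}^{n-1}(1-aq^j)$ and $${}_2\phi_1(a,\beta;c;q,z)=\sum_{n=0}^\infty\frac{(a;q)_n(\beta;q)_n}{(c;q)_n(q;q)_n}z^n .$$ Then $\{d_{k+1}^{(b)}\}_{k\ge1}$ is a positive chain sequence, it has a maximal parameter sequence $\{M_{k+1}^{(b)}\}_{k\ge0}$, and for every $k\ge0$ $$M_{k+1}^{(b)}=\frac12\,\frac{1-q^{\bar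 b+k}}{1-q^{\lambda+k}\cos\eta_q}\;\frac{{}_2\phi_1(q^{k},q^{-b+1};q^{\bar b+k};q,q^{b})}{{}_2\phi_1(q^{k+1},q^{-b+1};q^{\bar b+k+1};q,q^{b})},$$ where all the series converge absolutely and the denominators do not vanish. Moreover, $\lim_{k\to\infty}M_{k+1}^{(b)}=\frac12$. -/

import Mathlib

/-- The finite `q`-Pochhammer symbol `(a; q)_n = ∏_{j=0}^{n-1} (1 - a q^j)`. -/
noncomputable def qPoch (a q : ℂ) (n : ℕ) : ℂ :=
  ∏ j ∈ Finset.range n, (1 - a * q ^ j)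

/-- The `n`-th term of the basic hypergeometric series `₂φ₁(a, b; c; q, z)`. -/
noncomputable def phiTerm (a b c q z : ℂ) (n : ℕ) : ℂ :=
  qPoch a q n * qPoch b q n / (qPoch c q n * qPoch q q n) * z ^ n

/-- The basic hypergeometric series `₂φ₁(a, b; c; q, z)`. -/
noncomputable def phi21 (a b c q z : ℂ) : ℂ :=
  ∑' n : ℕ, phiTerm a b c q z n

/-- `g` (that is, `g_0, g_1, …`) is a parameter sequence of the sequence `a_1, a_2, …`:
`0 ≤ g_0 < 1`, `0 < g_n < 1` and `a_n = (1 - g_{n-1}) g_n` for `n ≥ 1`.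
The value `a 0` plays no role. -/
def IsParameterSequence (a g : ℕ → ℝ) : Prop :=
  (0 ≤ g 0 ∧ g 0 < 1) ∧
    (∀ n, 1 ≤ n → 0 < g n ∧ g n < 1) ∧
    ∀ n, 1 ≤ n → a n = (1 - g (n - 1)) * g n

/-- `a_1, a_2, …` is a positive chain sequence if it has a parameter sequence. -/
def IsPositiveChainSequence (a : ℕ → ℝ) : Prop :=
  ∃ g : ℕ → ℝ, IsParameterSequence a g

/-- `M` is the maximal parameter sequence of `a_1, a_2, …`: it is a parameter sequence
that dominates every other one termwise. -/
def IsMaximalParameterSequence (a M : ℕ → ℝ) : Prop :=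
  IsParameterSequence a M ∧ ∀ g : ℕ → ℝ, IsParameterSequence a g → ∀ n, g n ≤ M n

/-- `dSeq q lam eta k` is the coefficient `d_{k+1}^{(b)}` for `b = lam - i eta`,
with `eta_q = eta * log q`; the sequence of interest is `k ≥ 1`. -/
noncomputable def dSeq (q lam eta : ℝ) (k : ℕ) : ℝ :=
  (1 - q ^ k) * (1 - q ^ (2 * lam + (k : ℝ) - 1)) /
    (4 * (1 - q ^ (lam + (k : ℝ) - 1) * Real.cos (eta * Real.log q)) *
      (1 - q ^ (lam + (k : ℝ)) * Real.cos (eta * Real.log q)))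

/-- The `n`-th term of the series
`₂φ₁(q^k, q^{-b+1}; q^{conj b + k}; q, q^b)`. -/
noncomputable def phiBTerm (q : ℝ) (b : ℂ) (k n : ℕ) : ℂ :=
  phiTerm ((q : ℂ) ^ k) ((q : ℂ) ^ (-b + 1)) ((q : ℂ) ^ ((starRingEnd ℂ) b + (k : ℂ)))
    (q : ℂ) ((q : ℂ) ^ b) n

/-- The value `₂φ₁(q^k, q^{-b+1}; q^{conj b + k}; q, q^b)`. -/
noncomputable def phiB (q : ℝ) (b : ℂ) (k : ℕ) : ℂ :=
  phi21 ((q : ℂ) ^ k) ((q : ℂ) ^ (-b + 1)) ((q : ℂ) ^ ((starRingEnd ℂ) b + (k : ℂ)))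
    (q : ℂ) ((q : ℂ) ^ b)

open Filter Topology ComplexConjugate

/-! ### The finite `q`-Pochhammer symbol -/

/-! Put `β = q^b`, `c_k = 1 - q^k Re β` and `e_k = (1 - q^(k+1)) (1 - q^k |β|²)`, so that `0 < e_k ≤
1` and the chain sequence is `e_k / (4 c_k c_{k+1})`. Any positive solution of `2 c_k F_{k+1} = F_k
+ e_k F_{k+2}` gives a parameter sequence `F_k / (2 c_k F_{k+1})`. If `F` is also bounded, this
sequence is maximal: a larger parameter would produce a second positive solution `y` for which `y_k
/ F_k` drops by a fixed amount at every step (`isMaximalParameterSequence_of_bounded_solution`).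

A bounded positive solution comes from the series `∑ w_n q^(kn)` with positive weights `w_n = |(β;
q)_n / (q; q)_n|²` (`minimalSolution_recurrence`). It has a nonzero limit, whence the parameters
tend to `1/2`.

The complex values `₂φ₁ / (conj β; q)_k` satisfy the same recurrence by a telescoping contiguous
relation (`conjPhi_recurrence`) and also converge. Two convergent solutions are proportional
(`casoratian_eq_zero`), and the `₂φ₁` at `k = 0` equals `1`. This identifies the two solutions
(`conjPhi_eq`) and shows that no denominator vanishes. -/

lemma qPoch_zero (a q : ℂ) : qPoch a q 0 = 1 := by simp [qPoch]

lemma qPoch_succ (a q : ℂ) (n : ℕ) :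
    qPoch a q (n + 1) = qPoch a q n * (1 - a * q ^ n) := by
  simp [qPoch, Finset.prod_range_succ]

lemma qPoch_succ' (a q : ℂ) (n : ℕ) :
    qPoch a q (n + 1) = (1 - a) * qPoch (a * q) q n := by
  simp only [qPoch, Finset.prod_range_succ']
  rw [mul_comm]
  congr 1
  · simp
  · refine Finset.prod_congr rfl fun j _ => ?_
    ring

lemma continuous_qPoch (q : ℂ) (n : ℕ) : Continuous fun a => qPoch a q n := by
  unfold qPoch
  fun_prop

lemma summable_norm_mul_pow {q : ℂ} (hq : ‖q‖ < 1) (a : ℂ) :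
    Summable fun j : ℕ => ‖-(a * q ^ j)‖ := by
  simp only [norm_neg, norm_mul, norm_pow]
  exact (summable_geometric_of_lt_one (norm_nonneg _) hq).mul_left _

lemma tendsto_qPoch {q : ℂ} (hq : ‖q‖ < 1) (a : ℂ) :
    Tendsto (qPoch a q) atTop (𝓝 (∏' j : ℕ, (1 + -(a * q ^ j)))) := by
  refine (multipliable_one_add_of_summable
    (summable_norm_mul_pow hq a)).tendsto_prod_tprod_nat.congr fun n => ?_
  simp [qPoch, sub_eq_add_neg]

lemma one_sub_mul_pow_ne_zero {q a : ℂ} (hq : ‖q‖ ≤ 1) (ha : ‖a‖ < 1) (n : ℕ) :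
    1 - a * q ^ n ≠ 0 := by
  intro h
  have h1 : ‖a * q ^ n‖ = 1 := by rw [← sub_eq_zero.mp h, norm_one]
  have h2 : ‖a * q ^ n‖ < 1 := by
    rw [norm_mul, norm_pow]
    exact mul_lt_one_of_nonneg_of_lt_one_left (norm_nonneg _) ha (pow_le_one₀ (norm_nonneg _) hq)
  exact h2.ne h1

lemma qPoch_ne_zero {q a : ℂ} (hq : ‖q‖ ≤ 1) (ha : ‖a‖ < 1) (n : ℕ) : qPoch a q n ≠ 0 :=
  Finset.prod_ne_zero_iff.mpr fun j _ => one_sub_mul_pow_ne_zero hq ha j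

lemma tprod_qPoch_ne_zero {q a : ℂ} (hq : ‖q‖ < 1) (ha : ‖a‖ < 1) :
    (∏' j : ℕ, (1 + -(a * q ^ j))) ≠ 0 := by
  refine tprod_one_add_ne_zero_of_summable (fun j => ?_) (summable_norm_mul_pow hq a)
  simpa [sub_eq_add_neg] using one_sub_mul_pow_ne_zero hq.le ha j

lemma exists_norm_qPoch_le {q : ℂ} (hq : ‖q‖ < 1) (a : ℂ) :
    ∃ K, 0 < K ∧ ∀ n, ‖qPoch a q n‖ ≤ K := by
  obtain ⟨K, hK⟩ := (tendsto_qPoch hq a).norm.bddAbove_range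
  refine ⟨max K 1, by positivity, fun n => le_max_of_le_left (hK ⟨n, rfl⟩)⟩

/-- The symbols `(a; q)_n` are bounded away from zero, uniformly in `n` and in `‖a‖ ≤ r < 1`. -/
lemma exists_le_norm_qPoch {q r : ℝ} (hq0 : 0 ≤ q) (hq1 : q < 1) (hr0 : 0 ≤ r) (hr1 : r < 1) :
    ∃ c, 0 < c ∧ ∀ (a : ℂ) (n : ℕ), ‖a‖ ≤ r → c ≤ ‖qPoch a q n‖ := by
  have hq : ‖(q : ℂ)‖ < 1 := by simpa [abs_of_nonneg hq0] using hq1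
  have hr : ‖(r : ℂ)‖ < 1 := by simpa [abs_of_nonneg hr0] using hr1
  have hfac : ∀ j : ℕ, 0 ≤ 1 - r * q ^ j := fun j => by
    have : r * q ^ j ≤ 1 := mul_le_one₀ hr1.le (by positivity) (pow_le_one₀ hq0 hq1.le)
    linarith
  have hnorm : ∀ n, ‖qPoch r q n‖ = ∏ j ∈ Finset.range n, (1 - r * q ^ j) := fun n => by
    have : qPoch (r : ℂ) q n = ((∏ j ∈ Finset.range n, (1 - r * q ^ j) : ℝ) : ℂ) := by
      simp [qPoch]
    rw [this, Complex.norm_real, Real.norm_eq_abs,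
      abs_of_nonneg (Finset.prod_nonneg fun j _ => hfac j)]
  have hanti : Antitone fun n => ‖qPoch r q n‖ := antitone_nat_of_succ_le fun n => by
    rw [qPoch_succ, norm_mul]
    refine mul_le_of_le_one_right (norm_nonneg _) ?_
    have : (1 - (r : ℂ) * q ^ n) = ((1 - r * q ^ n : ℝ) : ℂ) := by push_cast; ring
    rw [this, Complex.norm_real, Real.norm_eq_abs, abs_of_nonneg (hfac n)]
    have : 0 ≤ r * q ^ n := by positivity
    linarith
  have hlim := (tendsto_qPoch hq (r : ℂ)).norm
  -- The constant is the modulus of `(r; q)_∞`: factor by factor, `|1 - a q^j| ≥ 1 - r q^j`.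
  refine ⟨_, norm_pos_iff.mpr (tprod_qPoch_ne_zero hq hr), fun a n ha => ?_⟩
  refine (hanti.le_of_tendsto hlim n).trans ?_
  rw [hnorm, qPoch, norm_prod]
  refine Finset.prod_le_prod (fun j _ => hfac j) fun j _ => ?_
  have h1 := norm_sub_norm_le (1 : ℂ) (a * q ^ j)
  have h2 : ‖a * (q : ℂ) ^ j‖ ≤ r * q ^ j := by
    rw [norm_mul, norm_pow, Complex.norm_real, Real.norm_eq_abs, abs_of_nonneg hq0]
    gcongr
  rw [norm_one] at h1
  linarith

/-! ### Chain sequences and three-term recurrences -/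

lemma IsMaximalParameterSequence.unique {a M N : ℕ → ℝ} (hM : IsMaximalParameterSequence a M)
    (hN : IsMaximalParameterSequence a N) : M = N :=
  funext fun n => le_antisymm (hN.2 M hM.1 n) (hM.2 N hN.1 n)

/-- Two convergent solutions of `2 c_k u_{k+1} = u_k + e_k u_{k+2}`, `|e_k| ≤ 1`, are
proportional, since their Casoratian tends to zero while its modulus does not decrease. -/
lemma casoratian_eq_zero {c e u v : ℕ → ℂ} (he1 : ∀ k, ‖e k‖ ≤ 1)
    (hu : ∀ k, 2 * c k * u (k + 1) = u k + e k * u (k + 2))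
    (hv : ∀ k, 2 * c k * v (k + 1) = v k + e k * v (k + 2))
    {l m : ℂ} (hul : Tendsto u atTop (𝓝 l)) (hvm : Tendsto v atTop (𝓝 m)) (k : ℕ) :
    u k * v (k + 1) = u (k + 1) * v k := by
  set W : ℕ → ℂ := fun k => u k * v (k + 1) - u (k + 1) * v k with hW
  have hstep : ∀ k, W k = e k * W (k + 1) := fun k => by
    simp only [hW]
    linear_combination (-v (k + 1)) * hu k + u (k + 1) * hv k
  have hmono : Monotone fun k => ‖W k‖ := monotone_nat_of_le_succ fun k => by
    rw [hstep k, norm_mul]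
    exact mul_le_of_le_one_left (norm_nonneg _) (he1 k)
  have hlim : Tendsto (fun k => ‖W k‖) atTop (𝓝 0) := by
    have h := (hul.mul (hvm.comp (tendsto_add_atTop_nat 1))).sub
      ((hul.comp (tendsto_add_atTop_nat 1)).mul hvm)
    simpa [hW] using h.norm
  have h0 : ‖W k‖ ≤ 0 := hmono.ge_of_tendsto hlim k
  exact sub_eq_zero.mp (norm_le_zero_iff.mp h0)

/-- A positive bounded solution of the recurrence has minimal ratios: the initial ratio of no other
positive solution, written as a sequence of parameters, exceeds it. -/
lemma parameter_le_of_bounded_solution {c e F g : ℕ → ℝ} {K : ℝ} (hc : ∀ k, 0 < c k)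
    (he0 : ∀ k, 0 < e k) (he1 : ∀ k, e k ≤ 1) (hF : ∀ k, 0 < F k) (hFK : ∀ k, F k ≤ K)
    (hrec : ∀ k, 2 * c k * F (k + 1) = F k + e k * F (k + 2))
    (hg : ∀ k, 0 < g k)
    (hge : ∀ k, (1 - g k) * g (k + 1) = e k / (4 * c k * c (k + 1))) :
    g 0 ≤ F 0 / (2 * c 0 * F 1) := by
  by_contra! hlt
  -- The positive solution whose consecutive ratios `y_n / y_{n+1}` are `2 c_n g_n`.
  set y : ℕ → ℝ := fun n => ∏ i ∈ Finset.range n, (1 / (2 * c i * g i)) with hy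
  have hy_pos : ∀ n, 0 < y n := fun n => Finset.prod_pos fun i _ => by
    have := hc i; have := hg i; positivity
  have hy_succ : ∀ n, 2 * c n * g n * y (n + 1) = y n := fun n => by
    have := (hc n).ne'; have := (hg n).ne'
    simp only [hy, Finset.prod_range_succ]
    field_simp
  have hy_rec : ∀ k, 2 * c k * y (k + 1) = y k + e k * y (k + 2) := fun k => by
    have h1 := hy_succ k
    have h2 := hy_succ (k + 1)
    have h3 := hge k
    have := (hc k).ne'; have := (hc (k + 1)).ne'
    field_simp at h3
    rw [← h1]
    have : y (k + 1) * (1 - g k) * (2 * c k) = e k * y (k + 2) := by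
      rw [← h2, ← h3]; ring
    linarith
  -- The Casoratian starts positive because `g 0` is too large, and `e_k ≤ 1` keeps it from
  -- decreasing.
  set W : ℕ → ℝ := fun k => F (k + 1) * y k - F k * y (k + 1) with hW
  have hstep : ∀ k, W k = e k * W (k + 1) := fun k => by
    simp only [hW]
    linear_combination (-F (k + 1)) * hy_rec k + y (k + 1) * hrec k
  have hW0 : 0 < W 0 := by
    have h1 := hy_succ 0
    have := hc 0; have := hF 1; have h3 := hy_pos 1
    rw [div_lt_iff₀ (by positivity)] at hlt
    simp only [hW]
    rw [← h1]
    simp only [zero_add]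
    nlinarith
  have hWpos : ∀ k, W 0 ≤ W k := fun k => by
    induction k with
    | zero => exact le_rfl
    | succ k ih =>
      have h1 := hstep k
      have h2 : 0 < W (k + 1) := by
        have : 0 < e k * W (k + 1) := by rw [← h1]; linarith
        exact (mul_pos_iff_of_pos_left (he0 k)).mp this
      have := mul_le_of_le_one_left h2.le (he1 k)
      linarith
  have hK : 0 < K := (hF 0).trans_le (hFK 0)
  set δ := W 0 / (K * K) with hδ
  have hδ0 : 0 < δ := by positivity
  have hdec : ∀ k, y (k + 1) / F (k + 1) ≤ y k / F k - δ := fun k => by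
    have h1 : y k / F k - y (k + 1) / F (k + 1) = W k / (F k * F (k + 1)) := by
      have := (hF k).ne'; have := (hF (k + 1)).ne'
      simp only [hW]; field_simp
    have h2 : δ ≤ W k / (F k * F (k + 1)) := by
      have := hF k; have := hF (k + 1)
      have := hWpos k
      exact div_le_div₀ (by linarith) this (by positivity)
        (mul_le_mul (hFK k) (hFK _) (hF _).le hK.le)
    linarith
  have hlin : ∀ k : ℕ, y k / F k ≤ y 0 / F 0 - k * δ := fun k => by
    induction k with
    | zero => simp
    | succ k ih => have := hdec k; push_cast; linarith
  obtain ⟨n, hn⟩ := exists_nat_gt (y 0 / F 0 / δ)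
  have h1 := hlin n
  have h2 : 0 < y n / F n := div_pos (hy_pos n) (hF n)
  rw [div_lt_iff₀ hδ0] at hn
  linarith

/-- A positive bounded solution of `2 c_k F_{k+1} = F_k + e_k F_{k+2}` yields the maximal parameter
sequence of `e_k / (4 c_k c_{k+1})`. -/
lemma isMaximalParameterSequence_of_bounded_solution {a c e F : ℕ → ℝ} {K : ℝ}
    (hc : ∀ k, 0 < c k) (he0 : ∀ k, 0 < e k) (he1 : ∀ k, e k ≤ 1) (hF : ∀ k, 0 < F k)
    (hFK : ∀ k, F k ≤ K) (hrec : ∀ k, 2 * c k * F (k + 1) = F k + e k * F (k + 2))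
    (ha : ∀ k, a (k + 1) = e k / (4 * c k * c (k + 1))) :
    IsMaximalParameterSequence a fun k => F k / (2 * c k * F (k + 1)) := by
  have hpos : ∀ k, 0 < F k / (2 * c k * F (k + 1)) := fun k => by
    have := hc k; have := hF k; have := hF (k + 1); positivity
  have hlt : ∀ k, F k / (2 * c k * F (k + 1)) < 1 := fun k => by
    have := hc k; have := hF (k + 1)
    rw [div_lt_one (by positivity), hrec k]
    have := mul_pos (he0 k) (hF (k + 2))
    linarith
  refine ⟨⟨⟨(hpos 0).le, hlt 0⟩, fun n _ => ⟨hpos n, hlt n⟩, fun n hn => ?_⟩, fun g hg n => ?_⟩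
  · obtain ⟨k, rfl⟩ := Nat.exists_eq_add_of_le' hn
    have h := hrec k
    have := (hc k).ne'; have := (hc (k + 1)).ne'
    have := (hF (k + 1)).ne'; have := (hF (k + 2)).ne'
    rw [ha, Nat.add_sub_cancel]
    have h2 : 1 - F k / (2 * c k * F (k + 1)) = e k * F (k + 2) / (2 * c k * F (k + 1)) := by
      field_simp
      linarith
    rw [h2]
    field_simp
    ring
  · obtain ⟨⟨h0, -⟩, hg1, hga⟩ := hg
    -- The comparison is applied to the tail starting at `n` and needs positive parameters; only `g
    -- 0` may be zero.
    by_cases hgn : 0 < g n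
    · have h := parameter_le_of_bounded_solution (c := fun k => c (n + k)) (e := fun k => e (n + k))
        (F := fun k => F (n + k)) (g := fun k => g (n + k)) (fun k => hc _) (fun k => he0 _)
        (fun k => he1 _) (fun k => hF _) (fun k => hFK _) (fun k => hrec _)
        (fun k => by
          rcases Nat.eq_zero_or_pos k with rfl | hk
          · exact hgn
          · exact (hg1 _ (by omega)).1)
        (fun k => by
          have := hga (n + k + 1) (by omega)
          rw [ha, Nat.add_sub_cancel] at this
          exact this.symm)
      simpa using h
    · exact (not_lt.mp hgn).trans (hpos n).le

/-! ### The positive solution of the recurrence -/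

/-- The weight `|(β; q)_n|² / |(q; q)_n|²`. -/
noncomputable def qWeight (q : ℝ) (β : ℂ) (n : ℕ) : ℝ :=
  ‖qPoch β q n‖ ^ 2 / ‖qPoch q q n‖ ^ 2

/-- The series `∑ |(β; q)_n|² / |(q; q)_n|² q^{kn}`. -/
noncomputable def qWeightSum (q : ℝ) (β : ℂ) (k : ℕ) : ℝ :=
  ∑' n : ℕ, qWeight q β n * (q ^ k) ^ n

/-- The limit of the weights. -/
noncomputable def qWeightLim (q : ℝ) (β : ℂ) : ℝ :=
  ‖∏' j : ℕ, (1 + -(β * (q : ℂ) ^ j))‖ ^ 2 / ‖∏' j : ℕ, (1 + -((q : ℂ) * (q : ℂ) ^ j))‖ ^ 2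

/-- The bounded positive solution of the three-term recurrence. -/
noncomputable def minimalSolution (q : ℝ) (β : ℂ) : ℕ → ℝ
  | 0 => qWeightLim q β
  | k + 1 => qWeightSum q β (k + 1) / ‖qPoch q q k‖

section

variable {q : ℝ} {β : ℂ}

lemma norm_ofReal_lt_one (hq0 : 0 < q) (hq1 : q < 1) : ‖(q : ℂ)‖ < 1 := by
  simpa [abs_of_pos hq0] using hq1

lemma qPoch_self_ne_zero (hq0 : 0 < q) (hq1 : q < 1) (n : ℕ) : qPoch q q n ≠ 0 :=
  qPoch_ne_zero (norm_ofReal_lt_one hq0 hq1).le (norm_ofReal_lt_one hq0 hq1) n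

lemma norm_qPoch_self_succ (hq0 : 0 < q) (hq1 : q < 1) (n : ℕ) :
    ‖qPoch q q (n + 1)‖ = ‖qPoch q q n‖ * (1 - q ^ (n + 1)) := by
  have h : (1 - (q : ℂ) * q ^ n) = ((1 - q ^ (n + 1) : ℝ) : ℂ) := by push_cast; ring
  have h2 : q ^ (n + 1) ≤ 1 := pow_le_one₀ hq0.le hq1.le
  rw [qPoch_succ, norm_mul, h, Complex.norm_real, Real.norm_eq_abs, abs_of_nonneg (by linarith)]

lemma qWeight_zero : qWeight q β 0 = 1 := by simp [qWeight, qPoch_zero]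

lemma qWeight_pos (hq0 : 0 < q) (hq1 : q < 1) (hβ : ‖β‖ < 1) (n : ℕ) : 0 < qWeight q β n := by
  have h1 := norm_pos_iff.mpr (qPoch_self_ne_zero hq0 hq1 n)
  have h2 := norm_pos_iff.mpr (qPoch_ne_zero (norm_ofReal_lt_one hq0 hq1).le hβ n)
  unfold qWeight
  positivity

lemma norm_sq_one_sub_mul (β : ℂ) (t : ℝ) :
    ‖1 - β * t‖ ^ 2 = 1 - 2 * β.re * t + ‖β‖ ^ 2 * t ^ 2 := by
  rw [← Complex.normSq_eq_norm_sq, ← Complex.normSq_eq_norm_sq, Complex.normSq_apply,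
    Complex.normSq_apply]
  simp
  ring

/-- Both factors are quadratic in `q^n`, which is why the generating series at `y`, `q y`, `q² y`
are linearly related. -/
lemma qWeight_succ (hq0 : 0 < q) (hq1 : q < 1) (n : ℕ) :
    qWeight q β (n + 1) * (1 - q ^ (n + 1)) ^ 2 =
      qWeight q β n * (1 - 2 * β.re * q ^ n + ‖β‖ ^ 2 * (q ^ n) ^ 2) := by
  have h1 := (norm_pos_iff.mpr (qPoch_self_ne_zero hq0 hq1 n)).ne'
  have h2 : 1 - q ^ (n + 1) ≠ 0 := (sub_pos.mpr (pow_lt_one₀ hq0.le hq1 (by omega))).ne'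
  rw [qWeight, qWeight, norm_qPoch_self_succ hq0 hq1, qPoch_succ, norm_mul, ← norm_sq_one_sub_mul]
  push_cast
  field_simp

lemma tendsto_qWeight (hq0 : 0 < q) (hq1 : q < 1) :
    Tendsto (qWeight q β) atTop (𝓝 (qWeightLim q β)) := by
  have hq := norm_ofReal_lt_one hq0 hq1
  exact ((tendsto_qPoch hq β).norm.pow 2).div ((tendsto_qPoch hq (q : ℂ)).norm.pow 2)
    (pow_ne_zero _ (norm_ne_zero_iff.mpr (tprod_qPoch_ne_zero hq hq)))

lemma qWeightLim_pos (hq0 : 0 < q) (hq1 : q < 1) (hβ : ‖β‖ < 1) : 0 < qWeightLim q β := by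
  have hq := norm_ofReal_lt_one hq0 hq1
  have h1 := norm_pos_iff.mpr (tprod_qPoch_ne_zero hq hβ)
  have h2 := norm_pos_iff.mpr (tprod_qPoch_ne_zero hq hq)
  unfold qWeightLim
  positivity

lemma exists_qWeight_le (hq0 : 0 < q) (hq1 : q < 1) :
    ∃ K, ∀ n, qWeight q β n ≤ K := by
  obtain ⟨K, hK⟩ := (tendsto_qWeight (β := β) hq0 hq1).bddAbove_range
  exact ⟨K, fun n => hK ⟨n, rfl⟩⟩

/-- The bound does not depend on `k`, so it serves both summability and dominated convergence as `k
→ ∞`. -/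
lemma norm_qWeight_mul_pow_le (hq0 : 0 < q) (hq1 : q < 1) (hβ : ‖β‖ < 1) {K : ℝ}
    (hK : ∀ n, qWeight q β n ≤ K) {k : ℕ} (hk : 1 ≤ k) (n : ℕ) :
    ‖qWeight q β n * (q ^ k) ^ n‖ ≤ K * q ^ n := by
  have h0 := (qWeight_pos hq0 hq1 hβ n).le
  rw [Real.norm_of_nonneg (by positivity)]
  have h1 : q ^ k ≤ q := pow_le_of_le_one hq0.le hq1.le (by omega)
  have h2 : (q ^ k) ^ n ≤ q ^ n := pow_le_pow_left₀ (by positivity) h1 n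
  exact mul_le_mul (hK n) h2 (by positivity) (h0.trans (hK n))

lemma summable_qWeight (hq0 : 0 < q) (hq1 : q < 1) (hβ : ‖β‖ < 1) {k : ℕ} (hk : 1 ≤ k) :
    Summable fun n => qWeight q β n * (q ^ k) ^ n := by
  obtain ⟨K, hK⟩ := exists_qWeight_le (β := β) hq0 hq1
  exact Summable.of_norm_bounded ((summable_geometric_of_lt_one hq0.le hq1).mul_left K)
    (norm_qWeight_mul_pow_le hq0 hq1 hβ hK hk)

lemma qWeightSum_pos (hq0 : 0 < q) (hq1 : q < 1) (hβ : ‖β‖ < 1) {k : ℕ} (hk : 1 ≤ k) :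
    0 < qWeightSum q β k :=
  (summable_qWeight hq0 hq1 hβ hk).tsum_pos
    (fun n => mul_nonneg (qWeight_pos hq0 hq1 hβ n).le (by positivity)) 0
    (by simp [qWeight_zero])

lemma tendsto_qWeightSum (hq0 : 0 < q) (hq1 : q < 1) (hβ : ‖β‖ < 1) :
    Tendsto (qWeightSum q β) atTop (𝓝 1) := by
  obtain ⟨K, hK⟩ := exists_qWeight_le (β := β) hq0 hq1
  have h := tendsto_tsum_of_dominated_convergence (𝓕 := atTop)
    (f := fun k n => qWeight q β n * (q ^ k) ^ n) (g := fun n => if n = 0 then 1 else 0)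
    ((summable_geometric_of_lt_one hq0.le hq1).mul_left K) (fun n => by
      rcases Nat.eq_zero_or_pos n with rfl | hn
      · simp [qWeight_zero]
      · have h1 := ((tendsto_pow_atTop_nhds_zero_of_lt_one hq0.le hq1).pow n).const_mul
          (qWeight q β n)
        simpa [hn.ne', zero_pow hn.ne'] using h1)
    ((eventually_ge_atTop 1).mono fun k hk n => norm_qWeight_mul_pow_le hq0 hq1 hβ hK hk n)
  rw [tsum_ite_eq] at h
  exact h

/-- The partial sums of the recurrence telescope. -/
lemma sum_range_recurrence (hq0 : 0 < q) (hq1 : q < 1) (y : ℝ) (N : ℕ) :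
    ∑ n ∈ Finset.range N, (2 * (1 - y * β.re) * (qWeight q β n * (q * y) ^ n) -
        (1 - y * ‖β‖ ^ 2) * (qWeight q β n * (q ^ 2 * y) ^ n)) =
      (1 - y) * ∑ n ∈ Finset.range N, qWeight q β n * y ^ n +
        qWeight q β N * (1 - q ^ N) ^ 2 * y ^ N := by
  induction N with
  | zero => simp
  | succ N ih =>
    rw [Finset.sum_range_succ, ih, Finset.sum_range_succ, qWeight_succ hq0 hq1]
    simp only [mul_pow, ← pow_mul]
    ring

/-- Partial sums are kept on the left because the series at `k = 0` diverges while its coefficient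
vanishes. -/
lemma tendsto_sum_range_recurrence (hq0 : 0 < q) (hq1 : q < 1) (hβ : ‖β‖ < 1) (k : ℕ) :
    Tendsto (fun N => (1 - q ^ k) * ∑ n ∈ Finset.range N, qWeight q β n * (q ^ k) ^ n +
        qWeight q β N * (1 - q ^ N) ^ 2 * (q ^ k) ^ N) atTop
      (𝓝 (2 * (1 - q ^ k * β.re) * qWeightSum q β (k + 1) -
        (1 - q ^ k * ‖β‖ ^ 2) * qWeightSum q β (k + 2))) := by
  have h1 := (summable_qWeight (β := β) hq0 hq1 hβ (k := k + 1) (by omega)).hasSum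
  have h2 := (summable_qWeight (β := β) hq0 hq1 hβ (k := k + 2) (by omega)).hasSum
  have h := ((h1.mul_left (2 * (1 - q ^ k * β.re))).sub
    (h2.mul_left (1 - q ^ k * ‖β‖ ^ 2))).tendsto_sum_nat
  refine h.congr fun N => ?_
  rw [← sum_range_recurrence hq0 hq1]
  refine Finset.sum_congr rfl fun n _ => ?_
  rw [show q ^ (k + 1) = q * q ^ k by ring, show q ^ (k + 2) = q ^ 2 * q ^ k by ring]

lemma tendsto_qWeight_mul (hq0 : 0 < q) (hq1 : q < 1) :
    Tendsto (fun N => qWeight q β N * (1 - q ^ N) ^ 2) atTop (𝓝 (qWeightLim q β)) := by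
  have h := (tendsto_qWeight (β := β) hq0 hq1).mul
    (((tendsto_pow_atTop_nhds_zero_of_lt_one hq0.le hq1).const_sub 1).pow 2)
  simpa using h

/-- At `k = 0` only the boundary term survives; its limit dictates the initial value of
`minimalSolution`. For `k ≥ 1` it is killed by `q^(kN)`. -/
lemma qWeightSum_recurrence_zero (hq0 : 0 < q) (hq1 : q < 1) (hβ : ‖β‖ < 1) :
    2 * (1 - β.re) * qWeightSum q β 1 - (1 - ‖β‖ ^ 2) * qWeightSum q β 2 = qWeightLim q β := by
  have h := tendsto_sum_range_recurrence hq0 hq1 hβ 0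
  simp only [pow_zero, sub_self, zero_mul, zero_add, one_mul, one_pow, mul_one] at h
  exact tendsto_nhds_unique h (tendsto_qWeight_mul hq0 hq1)

lemma qWeightSum_recurrence (hq0 : 0 < q) (hq1 : q < 1) (hβ : ‖β‖ < 1) {k : ℕ} (hk : 1 ≤ k) :
    2 * (1 - q ^ k * β.re) * qWeightSum q β (k + 1) -
      (1 - q ^ k * ‖β‖ ^ 2) * qWeightSum q β (k + 2) = (1 - q ^ k) * qWeightSum q β k := by
  have hk1 : q ^ k < 1 := pow_lt_one₀ hq0.le hq1 (by omega)
  have h2 := ((summable_qWeight (β := β) hq0 hq1 hβ hk).hasSum.tendsto_sum_nat.const_mul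
    (1 - q ^ k)).add ((tendsto_qWeight_mul (β := β) hq0 hq1).mul
      (tendsto_pow_atTop_nhds_zero_of_lt_one (by positivity) hk1))
  rw [mul_zero, add_zero] at h2
  exact tendsto_nhds_unique (tendsto_sum_range_recurrence hq0 hq1 hβ k) h2

lemma minimalSolution_pos (hq0 : 0 < q) (hq1 : q < 1) (hβ : ‖β‖ < 1) (k : ℕ) :
    0 < minimalSolution q β k := by
  cases k with
  | zero => exact qWeightLim_pos hq0 hq1 hβ
  | succ k =>
    exact div_pos (qWeightSum_pos hq0 hq1 hβ (by omega))
      (norm_pos_iff.mpr (qPoch_self_ne_zero hq0 hq1 k))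

/-- Dividing by `(q; q)_k` moves the factor `1 - q^k` of the series recurrence into the coefficient
`e_k`. -/
lemma minimalSolution_recurrence (hq0 : 0 < q) (hq1 : q < 1) (hβ : ‖β‖ < 1) (k : ℕ) :
    2 * (1 - q ^ k * β.re) * minimalSolution q β (k + 1) = minimalSolution q β k +
      (1 - q ^ (k + 1)) * (1 - q ^ k * ‖β‖ ^ 2) * minimalSolution q β (k + 2) := by
  have hne : ∀ n, 1 - q ^ (n + 1) ≠ 0 := fun n =>
    (sub_pos.mpr (pow_lt_one₀ hq0.le hq1 (by omega))).ne'
  cases k with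
  | zero =>
    have h := qWeightSum_recurrence_zero hq0 hq1 hβ
    have h1 := hne 0
    simp only [minimalSolution, norm_qPoch_self_succ hq0 hq1, qPoch_zero, norm_one]
    simp only [zero_add, pow_zero, pow_one, one_mul] at h1 ⊢
    rw [← h]
    field_simp
    ring
  | succ k =>
    have h := qWeightSum_recurrence hq0 hq1 hβ (k := k + 1) (by omega)
    have h1 := hne k
    have h2 := hne (k + 1)
    have h3 := norm_ne_zero_iff.mpr (qPoch_self_ne_zero hq0 hq1 k)
    simp only [minimalSolution, norm_qPoch_self_succ hq0 hq1]
    have hG : qWeightSum q β (k + 1) = (2 * (1 - q ^ (k + 1) * β.re) * qWeightSum q β (k + 1 + 1) -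
      (1 - q ^ (k + 1) * ‖β‖ ^ 2) * qWeightSum q β (k + 1 + 2)) / (1 - q ^ (k + 1)) := by
      rw [h]; field_simp
    rw [hG]
    field_simp
    ring

lemma tendsto_minimalSolution (hq0 : 0 < q) (hq1 : q < 1) (hβ : ‖β‖ < 1) :
    ∃ l, l ≠ 0 ∧ Tendsto (minimalSolution q β) atTop (𝓝 l) := by
  have hq := norm_ofReal_lt_one hq0 hq1
  have hne := norm_ne_zero_iff.mpr (tprod_qPoch_ne_zero hq hq)
  refine ⟨_, div_ne_zero one_ne_zero hne, (tendsto_add_atTop_iff_nat 1).mp ?_⟩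
  exact ((tendsto_qWeightSum hq0 hq1 hβ).comp (tendsto_add_atTop_nat 1)).div
    (tendsto_qPoch hq (q : ℂ)).norm hne

end

/-! ### The contiguous relation for the basic hypergeometric series -/

lemma phiTerm_zero (a b c q z : ℂ) : phiTerm a b c q z 0 = 1 := by
  simp [phiTerm, qPoch_zero]

/-- The partial sums of the contiguous relation telescope. -/
lemma sum_range_contiguous {q β γ x : ℂ} (hβ : β ≠ 0) (hx : 1 - x * q ≠ 0)
    (hγ : ∀ n : ℕ, 1 - γ * x * q ^ n ≠ 0) (hq : ∀ n : ℕ, 1 - q * q ^ n ≠ 0) (N : ℕ) :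
    ∑ n ∈ Finset.range (N + 1),
      ((1 - γ * x) * phiTerm x (q / β) (γ * x) q β n +
        (1 - x * q) * (1 - β * γ * x) / (1 - γ * x * q) *
          phiTerm (x * q * q) (q / β) (γ * x * q * q) q β n -
        (2 - x * (β + γ)) * phiTerm (x * q) (q / β) (γ * x * q) q β n) =
      x * (1 - γ) * (qPoch (x * q) q N * qPoch (q / β) q (N + 1) * β ^ (N + 1)) /
        (qPoch (γ * x * q) q (N + 1) * qPoch q q N) := by
  have hγ0 : 1 - γ * x ≠ 0 := by simpa using hγ 0
  have hγ1 : 1 - γ * x * q ≠ 0 := by simpa using hγ 1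
  induction N with
  | zero =>
    simp only [zero_add, Finset.sum_range_one, phiTerm_zero, qPoch_zero, qPoch_succ, pow_zero]
    field_simp
    ring
  | succ N ih =>
    rw [Finset.sum_range_succ, ih]
    have hγN : 1 - γ * x * q * q ^ N ≠ 0 := by
      have := hγ (N + 1)
      rwa [pow_succ', ← mul_assoc] at this
    have hγN1 : 1 - γ * x * q * q ^ (N + 1) ≠ 0 := by
      have := hγ (N + 2)
      rwa [pow_succ', ← mul_assoc] at this
    have hqN := hq N
    have hE : qPoch (γ * x * q) q N ≠ 0 := Finset.prod_ne_zero_iff.mpr fun j _ => by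
      have := hγ (j + 1)
      rwa [pow_succ', ← mul_assoc] at this
    have hQ : qPoch q q N ≠ 0 := Finset.prod_ne_zero_iff.mpr fun j _ => hq j
    -- All shifted symbols are reduced to common ones, leaving a rational identity in `x, β, γ, q,
    -- q^N`.
    have hx2 : qPoch (x * q * q) q (N + 1) = qPoch (x * q) q N * (1 - x * q * q ^ N) *
        (1 - x * q * q ^ (N + 1)) / (1 - x * q) := by
      rw [eq_div_iff hx, ← qPoch_succ, ← qPoch_succ, qPoch_succ' (x * q)]; ring
    have hγ2 : qPoch (γ * x * q * q) q (N + 1) = qPoch (γ * x * q) q N *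
        (1 - γ * x * q * q ^ N) * (1 - γ * x * q * q ^ (N + 1)) / (1 - γ * x * q) := by
      rw [eq_div_iff hγ1, ← qPoch_succ, ← qPoch_succ, qPoch_succ' (γ * x * q)]; ring
    have h1 : phiTerm x (q / β) (γ * x) q β (N + 1) = (1 - x) * qPoch (x * q) q N *
        qPoch (q / β) q (N + 1) / ((1 - γ * x) * qPoch (γ * x * q) q N *
          (qPoch q q N * (1 - q * q ^ N))) * β ^ (N + 1) := by
      rw [phiTerm, qPoch_succ' x, qPoch_succ' (γ * x), qPoch_succ q]
    have h2 : phiTerm (x * q) (q / β) (γ * x * q) q β (N + 1) = qPoch (x * q) q N *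
        (1 - x * q * q ^ N) * qPoch (q / β) q (N + 1) / (qPoch (γ * x * q) q N *
          (1 - γ * x * q * q ^ N) * (qPoch q q N * (1 - q * q ^ N))) * β ^ (N + 1) := by
      rw [phiTerm, qPoch_succ (x * q), qPoch_succ (γ * x * q), qPoch_succ q]
    have h3 : phiTerm (x * q * q) (q / β) (γ * x * q * q) q β (N + 1) =
        (qPoch (x * q) q N * (1 - x * q * q ^ N) * (1 - x * q * q ^ (N + 1)) / (1 - x * q)) *
        qPoch (q / β) q (N + 1) / ((qPoch (γ * x * q) q N *
        (1 - γ * x * q * q ^ N) * (1 - γ * x * q * q ^ (N + 1)) / (1 - γ * x * q)) *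
          (qPoch q q N * (1 - q * q ^ N))) * β ^ (N + 1) := by
      rw [phiTerm, hx2, hγ2, qPoch_succ q]
    rw [h1, h2, h3, qPoch_succ (q / β) q (N + 1), qPoch_succ (γ * x * q) q (N + 1),
      qPoch_succ (γ * x * q) q N, qPoch_succ (x * q) q N, qPoch_succ q q N, pow_succ β (N + 1)]
    generalize qPoch (x * q) q N = A
    generalize qPoch (q / β) q (N + 1) = D
    generalize qPoch (γ * x * q) q N = E at *
    generalize qPoch q q N = Q at *
    generalize β ^ (N + 1) = Z
    rw [pow_succ] at *
    generalize q ^ N = p at *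
    clear ih h1 h2 h3 hx2 hγ2 hγ hq
    generalize hu : 1 - γ * x = u at *
    generalize hu1 : 1 - γ * x * q = u₁ at *
    generalize hu2 : 1 - γ * x * q * p = u₂ at *
    generalize hu3 : 1 - γ * x * q * (p * q) = u₃ at *
    generalize hv : 1 - q * p = v at *
    generalize hw : 1 - x * q = w at *
    field_simp
    subst hu hu1 hu2 hu3 hv hw
    ring

/-- The `n`-th term of `₂φ₁(q^k, q/β; conj β q^k; q, β)`. -/
noncomputable def conjPhiTerm (q : ℝ) (β : ℂ) (k n : ℕ) : ℂ :=
  phiTerm ((q : ℂ) ^ k) (q / β) (conj β * (q : ℂ) ^ k) q β n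

/-- The value `₂φ₁(q^k, q/β; conj β q^k; q, β)`. -/
noncomputable def conjPhi (q : ℝ) (β : ℂ) (k : ℕ) : ℂ := ∑' n, conjPhiTerm q β k n

section

variable {q : ℝ} {β : ℂ}

lemma norm_conj_mul_pow_le (hq0 : 0 < q) (hq1 : q < 1) (k : ℕ) :
    ‖conj β * (q : ℂ) ^ k‖ ≤ ‖β‖ := by
  rw [norm_mul, norm_pow, Complex.norm_conj]
  exact mul_le_of_le_one_right (norm_nonneg _)
    (pow_le_one₀ (norm_nonneg _) (norm_ofReal_lt_one hq0 hq1).le)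

lemma norm_qPoch_pow_le_one (hq0 : 0 < q) (hq1 : q < 1) (k n : ℕ) :
    ‖qPoch ((q : ℂ) ^ k) q n‖ ≤ 1 := by
  rw [qPoch, norm_prod]
  refine Finset.prod_le_one (fun _ _ => norm_nonneg _) fun j _ => ?_
  have h : (1 - (q : ℂ) ^ k * q ^ j) = ((1 - q ^ (k + j) : ℝ) : ℂ) := by push_cast; ring
  have h1 : q ^ (k + j) ≤ 1 := pow_le_one₀ hq0.le hq1.le
  have h2 : 0 ≤ q ^ (k + j) := by positivity
  rw [h, Complex.norm_real, Real.norm_eq_abs, abs_of_nonneg (by linarith)]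
  linarith

/-- Uniformity in `k` is what allows the limit `k → ∞` under the sum. -/
lemma exists_norm_conjPhiTerm_le (hq0 : 0 < q) (hq1 : q < 1) (hβ : ‖β‖ < 1) :
    ∃ K, ∀ k n, ‖conjPhiTerm q β k n‖ ≤ K * ‖β‖ ^ n := by
  obtain ⟨K, hK0, hK⟩ := exists_norm_qPoch_le (norm_ofReal_lt_one hq0 hq1) (q / β)
  obtain ⟨c, hc0, hc⟩ := exists_le_norm_qPoch hq0.le hq1 (norm_nonneg β) hβ
  obtain ⟨d, hd0, hd⟩ := exists_le_norm_qPoch hq0.le hq1 hq0.le hq1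
  refine ⟨1 * K / (c * d), fun k n => ?_⟩
  have h1 := hc _ n (norm_conj_mul_pow_le (β := β) hq0 hq1 k)
  have h2 := hd q n (by simp [abs_of_pos hq0])
  rw [conjPhiTerm, phiTerm, norm_mul, norm_div, norm_mul, norm_mul, norm_pow]
  gcongr
  · exact norm_qPoch_pow_le_one hq0 hq1 k n
  · exact hK n

lemma summable_conjPhiTerm (hq0 : 0 < q) (hq1 : q < 1) (hβ : ‖β‖ < 1) (k : ℕ) :
    Summable (conjPhiTerm q β k) := by
  obtain ⟨K, hK⟩ := exists_norm_conjPhiTerm_le hq0 hq1 hβ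
  exact Summable.of_norm_bounded
    ((summable_geometric_of_lt_one (norm_nonneg _) hβ).mul_left K) (hK k)

/-- The series terminates at once, since `(1; q)_n = 0` for `n ≥ 1`. -/
lemma conjPhi_zero : conjPhi q β 0 = 1 := by
  rw [conjPhi, tsum_eq_single 0]
  · exact phiTerm_zero ..
  · intro n hn
    obtain ⟨m, rfl⟩ := Nat.exists_eq_succ_of_ne_zero hn
    simp [conjPhiTerm, phiTerm, qPoch_succ']

lemma tendsto_conjPhi (hq0 : 0 < q) (hq1 : q < 1) (hβ : ‖β‖ < 1) :
    ∃ l, Tendsto (conjPhi q β) atTop (𝓝 l) := by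
  obtain ⟨K, hK⟩ := exists_norm_conjPhiTerm_le hq0 hq1 hβ
  refine ⟨_, tendsto_tsum_of_dominated_convergence (𝓕 := atTop) (f := conjPhiTerm q β)
    (g := fun n => qPoch 0 q n * qPoch (q / β) q n / (qPoch (conj β * 0) q n * qPoch q q n) * β ^ n)
    ((summable_geometric_of_lt_one (norm_nonneg _) hβ).mul_left K) (fun n => ?_)
    (Eventually.of_forall hK)⟩
  have hpow := tendsto_pow_atTop_nhds_zero_of_norm_lt_one (norm_ofReal_lt_one hq0 hq1)
  have h1 := ((continuous_qPoch q n).tendsto 0).comp hpow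
  have h2 := ((continuous_qPoch q n).tendsto _).comp (hpow.const_mul (conj β))
  refine ((h1.mul_const _).div (h2.mul_const _) ?_).mul_const _
  refine mul_ne_zero ?_ (qPoch_self_ne_zero hq0 hq1 n)
  simp [qPoch]

/-- The telescoped relation at `x = q^k`, `γ = conj β`; its boundary term dies like `β^(N+1)`. -/
lemma conjPhi_recurrence (hq0 : 0 < q) (hq1 : q < 1) (hβ0 : β ≠ 0) (hβ : ‖β‖ < 1) (k : ℕ) :
    (1 - conj β * (q : ℂ) ^ k) * conjPhi q β k +
      (1 - (q : ℂ) ^ (k + 1)) * (1 - β * conj β * q ^ k) / (1 - conj β * q ^ (k + 1)) *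
        conjPhi q β (k + 2) = (2 - (q : ℂ) ^ k * (β + conj β)) * conjPhi q β (k + 1) := by
  have hq := norm_ofReal_lt_one hq0 hq1
  have h0 := (summable_conjPhiTerm hq0 hq1 hβ k).hasSum.mul_left (1 - conj β * (q : ℂ) ^ k)
  have h1 := (summable_conjPhiTerm hq0 hq1 hβ (k + 1)).hasSum.mul_left
    (2 - (q : ℂ) ^ k * (β + conj β))
  have h2 := (summable_conjPhiTerm hq0 hq1 hβ (k + 2)).hasSum.mul_left
    ((1 - (q : ℂ) ^ (k + 1)) * (1 - β * conj β * q ^ k) / (1 - conj β * q ^ (k + 1)))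
  have hsum := ((h0.add h2).sub h1).tendsto_sum_nat.comp (tendsto_add_atTop_nat 1)
  have hc1 : ‖conj β * (q : ℂ) ^ (k + 1)‖ < 1 := (norm_conj_mul_pow_le hq0 hq1 _).trans_lt hβ
  have hlim : Tendsto (fun N => (q : ℂ) ^ k * (1 - conj β) * (qPoch ((q : ℂ) ^ k * q) q N *
      qPoch (q / β) q (N + 1) * β ^ (N + 1)) / (qPoch (conj β * (q : ℂ) ^ k * q) q (N + 1) *
        qPoch q q N)) atTop (𝓝 0) := by
    have ha := tendsto_qPoch hq ((q : ℂ) ^ k * q)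
    have hb := (tendsto_qPoch hq (q / β)).comp (tendsto_add_atTop_nat 1)
    have hz := (tendsto_pow_atTop_nhds_zero_of_norm_lt_one hβ).comp (tendsto_add_atTop_nat 1)
    rw [pow_succ, ← mul_assoc] at hc1
    have hc := (tendsto_qPoch hq (conj β * (q : ℂ) ^ k * q)).comp (tendsto_add_atTop_nat 1)
    have hd := tendsto_qPoch hq (q : ℂ)
    have h := (((ha.mul hb).mul hz).const_mul ((q : ℂ) ^ k * (1 - conj β))).div (hc.mul hd)
      (mul_ne_zero (tprod_qPoch_ne_zero hq hc1) (tprod_qPoch_ne_zero hq hq))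
    simp only [mul_zero, zero_div] at h
    refine h.congr fun N => ?_
    simp
  have hx : 1 - (q : ℂ) ^ k * q ≠ 0 := by
    have := one_sub_mul_pow_ne_zero hq.le hq k
    rwa [mul_comm] at this
  have heq := tendsto_nhds_unique (hsum.congr fun N => by
    rw [← sum_range_contiguous hβ0 hx (fun n => one_sub_mul_pow_ne_zero hq.le
      ((norm_conj_mul_pow_le hq0 hq1 k).trans_lt hβ) n)
      (fun n => one_sub_mul_pow_ne_zero hq.le hq n)]
    refine Finset.sum_congr rfl fun n _ => ?_
    simp only [conjPhiTerm, pow_succ, mul_assoc]) hlim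
  exact sub_eq_zero.mp heq

/-- The hypergeometric values are proportional to the positive solution of the recurrence. -/
lemma conjPhi_eq (hq0 : 0 < q) (hq1 : q < 1) (hβ0 : β ≠ 0) (hβ : ‖β‖ < 1) (k : ℕ) :
    conjPhi q β k = qPoch (conj β) q k * (minimalSolution q β k / minimalSolution q β 0 : ℝ) := by
  have hq := norm_ofReal_lt_one hq0 hq1
  have hβ' : ‖conj β‖ < 1 := by rwa [Complex.norm_conj]
  have hP := fun n => qPoch_ne_zero hq.le hβ' n
  have hfac := fun n => one_sub_mul_pow_ne_zero hq.le hβ' n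
  have hF := fun n => minimalSolution_pos hq0 hq1 hβ n
  have hFc : ∀ n, (minimalSolution q β n : ℂ) ≠ 0 := fun n =>
    Complex.ofReal_ne_zero.mpr (hF n).ne'
  have hadd : β + conj β = 2 * (β.re : ℂ) := by rw [Complex.add_conj]; push_cast; ring
  have hmul : β * conj β = (‖β‖ : ℂ) ^ 2 := Complex.mul_conj' β
  obtain ⟨l, hl⟩ := tendsto_conjPhi hq0 hq1 hβ
  obtain ⟨m, -, hm⟩ := tendsto_minimalSolution hq0 hq1 hβ
  have hu := hl.div (tendsto_qPoch hq (conj β)) (tprod_qPoch_ne_zero hq hβ')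
  have hv := (Complex.continuous_ofReal.tendsto m).comp hm
  have hcas := casoratian_eq_zero (c := fun k => 1 - (q : ℂ) ^ k * (β.re : ℂ))
    (e := fun k => (((1 - q ^ (k + 1)) * (1 - q ^ k * ‖β‖ ^ 2) : ℝ) : ℂ))
    (fun k => by
      have h1 : q ^ (k + 1) ≤ 1 := pow_le_one₀ hq0.le hq1.le
      have h2 : q ^ k * ‖β‖ ^ 2 ≤ 1 := mul_le_one₀ (pow_le_one₀ hq0.le hq1.le) (by positivity)
        (pow_le_one₀ (norm_nonneg _) hβ.le)
      have h3 : 0 ≤ q ^ (k + 1) := by positivity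
      have h4 : 0 ≤ q ^ k * ‖β‖ ^ 2 := by positivity
      rw [Complex.norm_real, Real.norm_eq_abs,
        abs_of_nonneg (mul_nonneg (by linarith) (by linarith))]
      exact mul_le_one₀ (by linarith) (by linarith) (by linarith))
    (fun k => by
      have h := conjPhi_recurrence hq0 hq1 hβ0 hβ k
      rw [hadd, hmul] at h
      have hk := hP k
      have hk1 := hfac k
      have hk2 := hfac (k + 1)
      simp only [Pi.div_apply, qPoch_succ]
      push_cast
      generalize 1 - conj β * (q : ℂ) ^ k = s at *
      generalize 1 - conj β * (q : ℂ) ^ (k + 1) = t at *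
      field_simp at h ⊢
      linear_combination -h)
    (fun k => by
      have h := congrArg (fun r : ℝ => (r : ℂ)) (minimalSolution_recurrence hq0 hq1 hβ k)
      push_cast at h
      simp only [Function.comp_apply]
      push_cast
      linear_combination h) hu hv
  -- The vanishing Casoratian carries the ratio of the two solutions from `n` to `n + 1`; positivity
  -- of `minimalSolution` permits the division.
  have key : ∀ n, conjPhi q β n / qPoch (conj β) q n =
      (minimalSolution q β n / minimalSolution q β 0 : ℝ) := fun n => by
    induction n with
    | zero => simp [conjPhi_zero, qPoch_zero, (hF 0).ne']
    | succ n ih =>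
      have h := hcas n
      simp only [Pi.div_apply, Function.comp_apply, ih] at h
      have h0 := hFc 0
      have h1 := hFc n
      push_cast at h ⊢
      rw [eq_div_iff h0]
      field_simp at h
      rw [h]
      ring
  rw [← key k, mul_div_cancel₀ _ (hP k)]

end

/-! ### The parameters: limit, maximality and hypergeometric form -/

section

variable {q : ℝ} {β : ℂ}

lemma tendsto_parameter (hq0 : 0 < q) (hq1 : q < 1) (hβ : ‖β‖ < 1) :
    Tendsto (fun k => minimalSolution q β k /
      (2 * (1 - q ^ k * β.re) * minimalSolution q β (k + 1))) atTop (𝓝 (1 / 2)) := by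
  obtain ⟨l, hl0, hl⟩ := tendsto_minimalSolution hq0 hq1 hβ
  have hc := (((tendsto_pow_atTop_nhds_zero_of_lt_one hq0.le hq1).mul_const
    β.re).const_sub 1).const_mul 2
  rw [zero_mul, sub_zero, mul_one] at hc
  have h := hl.div (hc.mul (hl.comp (tendsto_add_atTop_nat 1))) (mul_ne_zero two_ne_zero hl0)
  rwa [div_mul_cancel_right₀ hl0, ← one_div] at h

lemma one_sub_pow_mul_re_pos (hq0 : 0 < q) (hq1 : q < 1) (hβ : ‖β‖ < 1) (k : ℕ) :
    0 < 1 - q ^ k * β.re := by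
  have h1 : q ^ k * β.re ≤ q ^ k * ‖β‖ :=
    mul_le_mul_of_nonneg_left (Complex.re_le_norm β) (by positivity)
  have h2 : q ^ k * ‖β‖ ≤ 1 * ‖β‖ :=
    mul_le_mul_of_nonneg_right (pow_le_one₀ hq0.le hq1.le) (norm_nonneg _)
  linarith

lemma isMaximalParameterSequence_minimalSolution {a : ℕ → ℝ} (hq0 : 0 < q) (hq1 : q < 1)
    (hβ : ‖β‖ < 1)
    (ha : ∀ k, a (k + 1) = (1 - q ^ (k + 1)) * (1 - q ^ k * ‖β‖ ^ 2) /
      (4 * (1 - q ^ k * β.re) * (1 - q ^ (k + 1) * β.re))) :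
    IsMaximalParameterSequence a fun k => minimalSolution q β k /
      (2 * (1 - q ^ k * β.re) * minimalSolution q β (k + 1)) := by
  obtain ⟨l, -, hl⟩ := tendsto_minimalSolution hq0 hq1 hβ
  obtain ⟨K, hK⟩ := hl.bddAbove_range
  have h1 : ∀ k, 0 < 1 - q ^ (k + 1) := fun k =>
    sub_pos.mpr (pow_lt_one₀ hq0.le hq1 (by omega))
  have h2 : ∀ k, 0 < 1 - q ^ k * ‖β‖ ^ 2 := fun k => by
    have h3 : ‖β‖ ^ 2 < 1 := pow_lt_one₀ (norm_nonneg _) hβ (by omega)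
    have h4 : q ^ k * ‖β‖ ^ 2 ≤ 1 * ‖β‖ ^ 2 :=
      mul_le_mul_of_nonneg_right (pow_le_one₀ hq0.le hq1.le) (by positivity)
    linarith
  refine isMaximalParameterSequence_of_bounded_solution (c := fun k => 1 - q ^ k * β.re)
    (e := fun k => (1 - q ^ (k + 1)) * (1 - q ^ k * ‖β‖ ^ 2))
    (one_sub_pow_mul_re_pos hq0 hq1 hβ) (fun k => mul_pos (h1 k) (h2 k)) (fun k => ?_)
    (minimalSolution_pos hq0 hq1 hβ) (fun k => hK ⟨k, rfl⟩)
    (minimalSolution_recurrence hq0 hq1 hβ) ha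
  have h5 : 0 ≤ q ^ (k + 1) := by positivity
  have h6 : 0 ≤ q ^ k * ‖β‖ ^ 2 := by positivity
  exact mul_le_one₀ (by linarith) (h2 k).le (by linarith)

/-- The factor `1 - conj β q^k` is the quotient of consecutive symbols `(conj β; q)_k`; the
normalisation at `0` cancels. -/
lemma parameter_eq_conjPhi_ratio (hq0 : 0 < q) (hq1 : q < 1) (hβ0 : β ≠ 0) (hβ : ‖β‖ < 1)
    (k : ℕ) :
    ((minimalSolution q β k / (2 * (1 - q ^ k * β.re) * minimalSolution q β (k + 1)) : ℝ) : ℂ) =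
      1 / 2 * ((1 - conj β * (q : ℂ) ^ k) / ((1 - q ^ k * β.re : ℝ) : ℂ)) *
        (conjPhi q β k / conjPhi q β (k + 1)) := by
  have hq := norm_ofReal_lt_one hq0 hq1
  have hβ' : ‖conj β‖ < 1 := by rwa [Complex.norm_conj]
  have hP := qPoch_ne_zero hq.le hβ' k
  have hfac := one_sub_mul_pow_ne_zero hq.le hβ' k
  have h0 : (minimalSolution q β 0 : ℂ) ≠ 0 :=
    Complex.ofReal_ne_zero.mpr (minimalSolution_pos hq0 hq1 hβ 0).ne'
  have h1 : (minimalSolution q β (k + 1) : ℂ) ≠ 0 :=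
    Complex.ofReal_ne_zero.mpr (minimalSolution_pos hq0 hq1 hβ (k + 1)).ne'
  have hc : ((1 - q ^ k * β.re : ℝ) : ℂ) ≠ 0 :=
    Complex.ofReal_ne_zero.mpr (one_sub_pow_mul_re_pos hq0 hq1 hβ k).ne'
  rw [conjPhi_eq hq0 hq1 hβ0 hβ, conjPhi_eq hq0 hq1 hβ0 hβ, qPoch_succ, Complex.ofReal_div,
    Complex.ofReal_div, Complex.ofReal_div, Complex.ofReal_mul, Complex.ofReal_mul]
  generalize ((1 - q ^ k * β.re : ℝ) : ℂ) = c at *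
  generalize 1 - conj β * (q : ℂ) ^ k = s at *
  push_cast
  field_simp

lemma conjPhi_ne_zero (hq0 : 0 < q) (hq1 : q < 1) (hβ0 : β ≠ 0) (hβ : ‖β‖ < 1) (k : ℕ) :
    conjPhi q β k ≠ 0 := by
  rw [conjPhi_eq hq0 hq1 hβ0 hβ]
  refine mul_ne_zero (qPoch_ne_zero (norm_ofReal_lt_one hq0 hq1).le (by simpa using hβ) k) ?_
  exact Complex.ofReal_ne_zero.mpr (div_pos (minimalSolution_pos hq0 hq1 hβ k)
    (minimalSolution_pos hq0 hq1 hβ 0)).ne'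

end

/-! ### Passage to the base `q^b` -/

section

variable {q : ℝ}

lemma ofReal_cpow_conj (hq0 : 0 < q) (b : ℂ) : (q : ℂ) ^ conj b = conj ((q : ℂ) ^ b) := by
  have h := Complex.cpow_conj (q : ℂ) b (by
    rw [Complex.arg_ofReal_of_nonneg hq0.le]; exact Real.pi_pos.ne)
  simpa using h

lemma ofReal_cpow_conj_add_natCast (hq0 : 0 < q) (b : ℂ) (k : ℕ) :
    (q : ℂ) ^ (conj b + (k : ℂ)) = conj ((q : ℂ) ^ b) * (q : ℂ) ^ k := by
  rw [Complex.cpow_add _ _ (Complex.ofReal_ne_zero.mpr hq0.ne'), Complex.cpow_natCast,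
    ofReal_cpow_conj hq0]

lemma phiBTerm_eq_conjPhiTerm (hq0 : 0 < q) (b : ℂ) (k : ℕ) :
    phiBTerm q b k = conjPhiTerm q ((q : ℂ) ^ b) k := by
  have hq : (q : ℂ) ≠ 0 := Complex.ofReal_ne_zero.mpr hq0.ne'
  funext n
  rw [phiBTerm, conjPhiTerm, ofReal_cpow_conj_add_natCast hq0, Complex.cpow_add _ _ hq,
    Complex.cpow_one, Complex.cpow_neg, inv_mul_eq_div]

lemma phiB_eq_conjPhi (hq0 : 0 < q) (b : ℂ) (k : ℕ) :
    phiB q b k = conjPhi q ((q : ℂ) ^ b) k := by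
  rw [conjPhi, ← phiBTerm_eq_conjPhiTerm hq0]
  rfl

lemma re_ofReal_cpow (hq0 : 0 < q) (lam eta : ℝ) :
    ((q : ℂ) ^ ((lam : ℂ) - Complex.I * (eta : ℂ))).re =
      q ^ lam * Real.cos (eta * Real.log q) := by
  rw [Complex.cpow_def_of_ne_zero (Complex.ofReal_ne_zero.mpr hq0.ne'), ← Complex.ofReal_log hq0.le,
    Complex.exp_re, Real.rpow_def_of_pos hq0]
  simp [mul_comm]

lemma dSeq_succ (hq0 : 0 < q) (lam eta : ℝ) (k : ℕ) :
    dSeq q lam eta (k + 1) = (1 - q ^ (k + 1)) * (1 - q ^ k * (q ^ lam) ^ 2) /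
      (4 * (1 - q ^ k * (q ^ lam * Real.cos (eta * Real.log q))) *
        (1 - q ^ (k + 1) * (q ^ lam * Real.cos (eta * Real.log q)))) := by
  have h1 : q ^ (2 * lam + ((k + 1 : ℕ) : ℝ) - 1) = q ^ k * (q ^ lam) ^ 2 := by
    rw [show 2 * lam + ((k + 1 : ℕ) : ℝ) - 1 = lam * (2 : ℕ) + k by push_cast; ring,
      Real.rpow_add hq0, Real.rpow_natCast, Real.rpow_mul hq0.le, Real.rpow_natCast, mul_comm]
  have h2 : q ^ (lam + ((k + 1 : ℕ) : ℝ) - 1) = q ^ k * q ^ lam := by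
    rw [show lam + ((k + 1 : ℕ) : ℝ) - 1 = lam + k by push_cast; ring,
      Real.rpow_add hq0, Real.rpow_natCast, mul_comm]
  have h3 : q ^ (lam + ((k + 1 : ℕ) : ℝ)) = q ^ (k + 1) * q ^ lam := by
    rw [Real.rpow_add hq0, Real.rpow_natCast, mul_comm]
  rw [dSeq, h1, h2, h3, mul_assoc (q ^ k), mul_assoc (q ^ (k + 1))]

end

theorem theorem5p2 (q lam eta : ℝ) (b : ℂ) (hq0 : 0 < q) (hq1 : q < 1) (hlam : 0 < lam)
    (hb : b = (lam : ℂ) - Complex.I * (eta : ℂ)) :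
    IsPositiveChainSequence (dSeq q lam eta) ∧
    (∃ M : ℕ → ℝ, IsMaximalParameterSequence (dSeq q lam eta) M) ∧
    (∀ k : ℕ, Summable (phiBTerm q b k) ∧ phiB q b (k + 1) ≠ 0) ∧
    ∀ M : ℕ → ℝ, IsMaximalParameterSequence (dSeq q lam eta) M →
      (∀ k : ℕ, (M k : ℂ) =
        1 / 2 * ((1 - (q : ℂ) ^ ((starRingEnd ℂ) b + (k : ℂ))) /
          (1 - ((q ^ (lam + (k : ℝ)) * Real.cos (eta * Real.log q) : ℝ) : ℂ))) *
          (phiB q b k / phiB q b (k + 1))) ∧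
      Filter.Tendsto M Filter.atTop (nhds (1 / 2)) := by
  set β : ℂ := (q : ℂ) ^ b with hβdef
  have hre : β.re = q ^ lam * Real.cos (eta * Real.log q) := by
    rw [hβdef, hb, re_ofReal_cpow hq0]
  have hnorm : ‖β‖ = q ^ lam := by
    rw [hβdef, Complex.norm_cpow_eq_rpow_re_of_pos hq0, hb]
    simp
  have hβ : ‖β‖ < 1 := hnorm ▸ Real.rpow_lt_one hq0.le hq1 hlam
  have hβ0 : β ≠ 0 := norm_pos_iff.mp (hnorm ▸ Real.rpow_pos_of_pos hq0 lam)
  have hmax := isMaximalParameterSequence_minimalSolution (a := dSeq q lam eta) hq0 hq1 hβ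
    fun k => by rw [dSeq_succ hq0, hnorm, hre]
  refine ⟨⟨_, hmax.1⟩, ⟨_, hmax⟩, fun k => ⟨?_, ?_⟩, fun M hM => ?_⟩
  · rw [phiBTerm_eq_conjPhiTerm hq0]
    exact summable_conjPhiTerm hq0 hq1 hβ k
  · rw [phiB_eq_conjPhi hq0]
    exact conjPhi_ne_zero hq0 hq1 hβ0 hβ _
  -- A maximal parameter sequence is unique, so the arbitrary `M` is the one constructed.
  · obtain rfl := hM.unique hmax
    refine ⟨fun k => ?_, tendsto_parameter hq0 hq1 hβ⟩
    have hc : (1 : ℂ) - ((q ^ (lam + (k : ℝ)) * Real.cos (eta * Real.log q) : ℝ) : ℂ) =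
        ((1 - q ^ k * β.re : ℝ) : ℂ) := by
      rw [hre, Real.rpow_add hq0, Real.rpow_natCast]
      push_cast
      ring
    rw [hc, phiB_eq_conjPhi hq0, phiB_eq_conjPhi hq0, ofReal_cpow_conj_add_natCast hq0]
    exact parameter_eq_conjPhi_ratio hq0 hq1 hβ0 hβ k
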